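/- Let $\Bbbk$ be a field in which every element is a square and let $\Gamma=(V,E)$ be a finite connected simple graph. A collection of skew-zigzag coefficients is a family $v=(v^a_{b,c}\in\Bbbk)$, indexed by a vertex $a$ and two neighbours $b,c$ of $a$, with $v^a_{b,b}=1$, $v^a_{b,c}v^a_{c,b}=1$ and $v^a_{b,c}v^a_{c,d}v^a_{d,b}=1$. Under pointwise multiplication these form a group $\mathrm{SZC}$. The double graph $D\Gamma$ is the quiver on $V$ with one directed edge $(a|b)$ for each ordered pair of adjacent vertices. The skew-zigzag algebra $A_v(\Gamma)$ is: the algebra generated by $1$ and $X$ with $X^2=0$ if $|V|=1$ (where $[a]=1$ for the vertex $a$); the path algebra $\Bbbk D\Gamma$ modulo the two-sided ideal generated by all paths of length greater than two if $|V|=2$; and $\Bbbk D\Gamma$ modulo the two-sided ideal generated by all paths $(a|b|c)$ with $a\neq c$ and all elements $(a|b|a)-v^a_{b,c}(a|c|a)$ if $|V|\geq 3$. Let $[a]\in A_v(\Gamma)$ be the class of the trivial path at $a$. Write $v\equiv u$, and also $A_v(\Gamma)\sim A_u(\Gamma)$, if there is an algebra isomorphism $\phi\colon A_v(\Gamma)\to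 A_u(\Gamma)$ with $\phi([a])=[a]$ for all $a\in V$. Let $\Sigma=\{A_v(\Gamma)\mid v\in\mathrm{SZC}\}$. Let $\mathcal C$ be the kernel of the homomorphism from the free abelian group on the directed edges of $D\Gamma$, modulo all $(a|b)+(b|a)$, to $\mathbb ZV$ that sends $(a|b)$ to $a-b$, and put $H^1(\Gamma,\Bbbk^*)=\mathrm{Hom}(\mathcal C,\Bbbk^*)$, a group under pointwise multiplication. For a cycle $P=(a_1|\cdots|a_n)$ with $a_n=a_1$, let $v_P^{\mathrm{cycle}}=v^{a_1}_{a_{n-1},a_2}\prod_{i=2}^{n-1}v^{a_i}_{a_{i-1},a_{i+1}}$ (equal to $1$ if $n=1$). **Theorem.** The relation $\equiv$ is a congruence on the group $\mathrm{SZC}$; the map $[A_v(\Gamma)]\mapsto[v]$ is a well-defined bijection $\Sigma/{\sim}\to\mathrm{SZC}/{\equiv}$; and there is an isomorphism of groups $\mathrm{SZC}/{\equiv}\;\cong H^1(\Gamma,\Bbbk^*)$ that sends $[v]$ to the homomorphism taking the value $v_P^{\mathrm{cycle}}$ on the class $\sum_{i=1}^{n-1}(a_i|a_{i+1})$ of every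 cycle $P=(a_1|\cdots|a_n)$. Moreover, an algebra isomorphism $A_v(\Gamma)\to A_u(\Gamma)$ fixing all $[a]$ exists if and only if such an isomorphism of graded algebras exists, for the grading by path length (with $X$ in degree $2$ if $|V|=1$). -/

import Mathlib

universe u w

namespace SkewZigzagAlgebra

noncomputable section

/-! ### The path algebra of the double graph -/

/-- Paths in the double graph of `G`, bundled with source and target. The double graph has one
directed edge `(a | b)` for every ordered pair of adjacent vertices, so its paths, including the
trivial ones, are the walks of `G`. -/
abbrev DPath {V : Type w} (G : SimpleGraph V) : Type w :=
  (a : V) × (b : V) × G.Walk a b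

/-- The underlying vector space of the path algebra of the double graph: the vector space with
basis all paths. -/
def PathAlgebra (k : Type u) {V : Type w} [Field k] (G : SimpleGraph V) : Type (max u w) :=
  DPath G →₀ k

namespace PathAlgebra

variable (k : Type u) {V : Type w} [Field k] (G : SimpleGraph V)

instance : AddCommGroup (PathAlgebra k G) := inferInstanceAs (AddCommGroup (DPath G →₀ k))

instance : Module k (PathAlgebra k G) := inferInstanceAs (Module k (DPath G →₀ k))

variable {G}

/-- The basis vector attached to a path. -/
def of {a b : V} (p : G.Walk a b) : PathAlgebra k G :=
  Finsupp.single (⟨a, b, p⟩ : DPath G) (1 : k)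

variable {k}

/-- Linear maps out of the path algebra agree if they agree on paths. -/
theorem lin_ext {M : Type*} [AddCommMonoid M] [Module k M] {f g : PathAlgebra k G →ₗ[k] M}
    (h : ∀ (a b : V) (p : G.Walk a b), f (of k p) = g (of k p)) : f = g := by
  refine Finsupp.lhom_ext' (M := k) (R := k) (α := DPath G) fun x => LinearMap.ext_ring ?_
  obtain ⟨a, b, p⟩ := x
  exact h a b p

variable [DecidableEq V]

/-- Product of two paths: their concatenation if the first ends where the second starts, and `0`
otherwise. -/
def concat (p q : DPath G) : PathAlgebra k G :=
  if h : p.2.1 = q.1 then of k (p.2.2.append (q.2.2.copy h.symm rfl)) else 0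

/-- The bilinear extension of the concatenation of paths. -/
def mulLin : PathAlgebra k G →ₗ[k] PathAlgebra k G →ₗ[k] PathAlgebra k G :=
  Finsupp.linearCombination k fun p : DPath G =>
    (Finsupp.linearCombination k fun q : DPath G => concat p q :
      (DPath G →₀ k) →ₗ[k] PathAlgebra k G)

instance : Mul (PathAlgebra k G) := ⟨fun x y => mulLin x y⟩

theorem mulLin_apply (x y : PathAlgebra k G) : mulLin x y = x * y := rfl

theorem of_mul_of_eq_concat {a b c d : V} (p : G.Walk a b) (q : G.Walk c d) :
    of k p * of k q = concat (k := k) (⟨a, b, p⟩ : DPath G) (⟨c, d, q⟩ : DPath G) := by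
  have h1 : (mulLin (of k p) : PathAlgebra k G →ₗ[k] PathAlgebra k G) =
      (Finsupp.linearCombination k fun q : DPath G => concat (k := k) (⟨a, b, p⟩ : DPath G) q :
        (DPath G →₀ k) →ₗ[k] PathAlgebra k G) :=
    (Finsupp.linearCombination_single k (1 : k) (⟨a, b, p⟩ : DPath G)).trans (one_smul k _)
  rw [← mulLin_apply, h1]
  exact (Finsupp.linearCombination_single k (1 : k) (⟨c, d, q⟩ : DPath G)).trans (one_smul k _)

theorem of_mul_of {a b c : V} (p : G.Walk a b) (q : G.Walk b c) :
    of k p * of k q = of k (p.append q) := by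
  rw [of_mul_of_eq_concat]
  exact dif_pos rfl

theorem of_mul_of_ne {a b c d : V} (p : G.Walk a b) (q : G.Walk c d) (h : b ≠ c) :
    of k p * of k q = 0 := by
  rw [of_mul_of_eq_concat]
  exact dif_neg h

/-- The unit: the sum of all trivial paths. -/
instance [Fintype V] : One (PathAlgebra k G) := ⟨∑ a : V, of k (SimpleGraph.Walk.nil : G.Walk a a)⟩

theorem assoc_aux (x y z : PathAlgebra k G) : x * y * z = x * (y * z) := by
  have key : (LinearMap.llcomp k (PathAlgebra k G) (PathAlgebra k G)
        (PathAlgebra k G →ₗ[k] PathAlgebra k G) mulLin).comp mulLin =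
      ((LinearMap.llcomp k (PathAlgebra k G) (PathAlgebra k G) (PathAlgebra k G)).flip.comp
        mulLin).flip.comp mulLin := by
    refine lin_ext fun a b p => lin_ext fun c d q => lin_ext fun e f r => ?_
    change of k p * of k q * of k r = of k p * (of k q * of k r)
    by_cases h1 : b = c
    · subst h1
      by_cases h2 : d = e
      · subst h2
        simp only [of_mul_of, SimpleGraph.Walk.append_assoc]
      · rw [of_mul_of, of_mul_of_ne _ _ h2, of_mul_of_ne _ _ h2, ← mulLin_apply, map_zero]
    · rw [of_mul_of_ne _ _ h1]
      by_cases h2 : d = e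
      · subst h2
        rw [of_mul_of, of_mul_of_ne _ _ h1, ← mulLin_apply, map_zero, LinearMap.zero_apply]
      · rw [of_mul_of_ne _ _ h2, ← mulLin_apply, ← mulLin_apply, map_zero, map_zero,
          LinearMap.zero_apply]
  exact congrArg (fun F => F x y z) key

theorem one_mul_aux [Fintype V] (x : PathAlgebra k G) : 1 * x = x := by
  have key : mulLin (1 : PathAlgebra k G) = LinearMap.id := by
    refine lin_ext fun a b p => ?_
    rw [show (1 : PathAlgebra k G) = ∑ a : V, of k (SimpleGraph.Walk.nil : G.Walk a a) from rfl,
      map_sum, LinearMap.sum_apply, Finset.sum_eq_single a]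
    · rw [mulLin_apply, of_mul_of]; rfl
    · intro c _ hc
      rw [mulLin_apply, of_mul_of_ne _ _ hc]
    · simp
  exact congrArg (fun F => F x) key

theorem mul_one_aux [Fintype V] (x : PathAlgebra k G) : x * 1 = x := by
  have key : mulLin.flip (1 : PathAlgebra k G) = LinearMap.id := by
    refine lin_ext fun a b p => ?_
    rw [LinearMap.flip_apply, show (1 : PathAlgebra k G) = ∑ a : V, of k (SimpleGraph.Walk.nil : G.Walk a a) from rfl,
      map_sum, Finset.sum_eq_single b]
    · rw [mulLin_apply, of_mul_of, SimpleGraph.Walk.append_nil]; rfl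
    · intro c _ hc
      rw [mulLin_apply, of_mul_of_ne _ _ (Ne.symm hc)]
    · simp
  exact congrArg (fun F => F x) key

instance [Fintype V] : Ring (PathAlgebra k G) where
  __ := (inferInstance : AddCommGroup (PathAlgebra k G))
  mul := (· * ·)
  one := 1
  mul_assoc := assoc_aux
  one_mul := one_mul_aux
  mul_one := mul_one_aux
  left_distrib x y z := map_add (mulLin x) y z
  right_distrib x y z := by
    change mulLin (x + y) z = mulLin x z + mulLin y z
    rw [map_add, LinearMap.add_apply]
  zero_mul x := by
    change mulLin 0 x = 0
    rw [map_zero, LinearMap.zero_apply]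
  mul_zero x := map_zero (mulLin x)

instance [Fintype V] : Algebra k (PathAlgebra k G) :=
  Algebra.ofModule
    (fun r x y => by
      change mulLin (r • x) y = r • mulLin x y
      rw [map_smul, LinearMap.smul_apply])
    (fun r x y => map_smul (mulLin x) r y)

end PathAlgebra

/-! ### Skew-zigzag coefficients -/

/-- Collections `(v^a_{b,c})` of skew-zigzag coefficients, indexed by a vertex `a` and two
neighbours `b`, `c` of `a`. -/
@[ext]
structure SZC (k : Type u) {V : Type w} [Field k] (G : SimpleGraph V) where
  /-- The coefficient `v^a_{b,c}`. -/
  coeff : (a : V) → G.neighborSet a → G.neighborSet a → k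
  self : ∀ a b, coeff a b b = 1
  symm : ∀ a b c, coeff a b c * coeff a c b = 1
  cocycle : ∀ a b c d, coeff a b c * coeff a c d * coeff a d b = 1

namespace SZC

variable {k : Type u} {V : Type w} [Field k] {G : SimpleGraph V}

/-- The group structure: pointwise multiplication. -/
instance : CommGroup (SZC k G) where
  mul x y :=
    { coeff := fun a b c => x.coeff a b c * y.coeff a b c
      self := fun a b => by rw [x.self, y.self, one_mul]
      symm := fun a b c => by rw [mul_mul_mul_comm, x.symm, y.symm, one_mul]
      cocycle := fun a b c d => by
        rw [mul_mul_mul_comm (x.coeff a b c), mul_mul_mul_comm (_ * _), x.cocycle, y.cocycle,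
          one_mul] }
  one :=
    { coeff := fun _ _ _ => 1
      self := fun _ _ => rfl
      symm := fun _ _ _ => one_mul 1
      cocycle := fun _ _ _ _ => by rw [one_mul, one_mul] }
  inv x :=
    { coeff := fun a b c => (x.coeff a b c)⁻¹
      self := fun a b => by rw [x.self, inv_one]
      symm := fun a b c => by rw [← mul_inv, x.symm, inv_one]
      cocycle := fun a b c d => by rw [← mul_inv, ← mul_inv, x.cocycle, inv_one] }
  mul_assoc x y z := SZC.ext (by funext a b c; exact mul_assoc _ _ _)
  one_mul x := SZC.ext (by funext a b c; exact one_mul _)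
  mul_one x := SZC.ext (by funext a b c; exact mul_one _)
  mul_comm x y := SZC.ext (by funext a b c; exact mul_comm _ _)
  inv_mul_cancel x := SZC.ext (by
    funext a b c
    exact inv_mul_cancel₀ (left_ne_zero_of_mul_eq_one (x.symm a b c)))

/-- The product of `v` along a path `(a₁ | ⋯ | aₙ)`: the product of `v^{aᵢ}_{aᵢ₋₁,aᵢ₊₁}` over the
interior positions `1 < i < n`. -/
def pathProd (v : SZC k G) : {a b : V} → G.Walk a b → k
  | _, _, .nil => 1
  | _, _, .cons _ .nil => 1
  | a, _, .cons (v := b) h (.cons (v := c) h' p) =>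
      v.coeff b ⟨a, h.symm⟩ ⟨c, h'⟩ * pathProd v (.cons h' p)

open Classical in
/-- The cycle product of `v` along a cycle `(a₁ | ⋯ | aₙ = a₁)`, namely `v^{a₁}_{aₙ₋₁,a₂}` times the
product along the path; it is `1` for the trivial cycle `(a)`. -/
def cycleProd (v : SZC k G) {a : V} (p : G.Walk a a) : k :=
  if h : p.Nil then 1
  else v.coeff a ⟨p.penultimate, (p.adj_penultimate h).symm⟩ ⟨p.snd, p.adj_snd h⟩ * v.pathProd p

end SZC

/-! ### Skew-zigzag algebras -/

/-- An algebra with a distinguished family of elements indexed by the vertices and a family of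
homogeneous pieces. It serves to collect the skew-zigzag algebras, with their elements `[a]` and
their gradings, into one set. -/
structure VertexAlgebra (k : Type u) [Field k] (V : Type w) where
  carrier : Type (max u w)
  [ring : Ring carrier]
  [algebra : Algebra k carrier]
  /-- The element `[a]` attached to the vertex `a`. -/
  vertex : V → carrier
  /-- The homogeneous piece of degree `i`. -/
  piece : ℕ → Submodule k carrier

attribute [instance] VertexAlgebra.ring VertexAlgebra.algebra

namespace VertexAlgebra

variable {k : Type u} [Field k] {V : Type w}

/-- There is an isomorphism of algebras fixing the vertices. -/
def VertexIso (A B : VertexAlgebra.{u, w} k V) : Prop :=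
  ∃ φ : A.carrier ≃ₐ[k] B.carrier, ∀ a, φ (A.vertex a) = B.vertex a

/-- There is an isomorphism of graded algebras fixing the vertices. -/
def GradedVertexIso (A B : VertexAlgebra.{u, w} k V) : Prop :=
  ∃ φ : A.carrier ≃ₐ[k] B.carrier, (∀ a, φ (A.vertex a) = B.vertex a) ∧
    ∀ i, (A.piece i).map φ.toLinearMap = B.piece i

theorem vertexIso_equivalence : Equivalence (VertexIso (k := k) (V := V)) where
  refl A := ⟨AlgEquiv.refl, fun _ => rfl⟩
  symm := by
    rintro A B ⟨φ, h⟩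
    exact ⟨φ.symm, fun a => by rw [← h, AlgEquiv.symm_apply_apply]⟩
  trans := by
    rintro A B C ⟨φ, h⟩ ⟨ψ, h'⟩
    exact ⟨φ.trans ψ, fun a => by rw [AlgEquiv.trans_apply, h, h']⟩

end VertexAlgebra

section Algebra

variable {k : Type u} {V : Type w} [Field k] [Fintype V] [DecidableEq V] {G : SimpleGraph V}

open SimpleGraph (Walk)

variable (k G) in
/-- The two-sided ideal generated by all paths of length greater than two. -/
def longPathIdeal : TwoSidedIdeal (PathAlgebra k G) :=
  TwoSidedIdeal.span {x | ∃ (a b : V) (p : G.Walk a b), 2 < p.length ∧ x = PathAlgebra.of k p}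

/-- The ideal `I_v`, generated by the paths `(a₁ | a₂ | a₃)` with `a₁ ≠ a₃` and by the elements
`(a₁ | a₂ | a₁) - v^{a₁}_{a₂,a₃} (a₁ | a₃ | a₁)`. -/
def relIdeal (v : SZC k G) : TwoSidedIdeal (PathAlgebra k G) :=
  TwoSidedIdeal.span
    ({x | ∃ (a b c : V) (h : G.Adj a b) (h' : G.Adj b c), a ≠ c ∧
        x = PathAlgebra.of k (Walk.cons h (Walk.cons h' Walk.nil))} ∪
     {x | ∃ (a b c : V) (h : G.Adj a b) (h' : G.Adj a c),
        x = PathAlgebra.of k (Walk.cons h (Walk.cons h.symm Walk.nil)) -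
          v.coeff a ⟨b, h⟩ ⟨c, h'⟩ • PathAlgebra.of k (Walk.cons h' (Walk.cons h'.symm Walk.nil))})

/-- The quotient of the path algebra by a two-sided ideal, with the classes of the trivial paths
and the grading by path length. -/
def quotientAlgebra (I : TwoSidedIdeal (PathAlgebra k G)) : VertexAlgebra.{u, w} k V where
  carrier := PathAlgebra k G ⧸ I.asIdeal
  vertex a := Ideal.Quotient.mk I.asIdeal (PathAlgebra.of k (Walk.nil : G.Walk a a))
  piece i := Submodule.span k
    {x | ∃ (a b : V) (p : G.Walk a b), p.length = i ∧
      x = Ideal.Quotient.mk I.asIdeal (PathAlgebra.of k p)}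

variable (k V) in
/-- The algebra generated by `1` and `X` with `X ^ 2 = 0`, for the graph with a single vertex `a`;
here `[a] = 1`, and `X` has degree two. -/
def dualNumberAlgebra : VertexAlgebra.{u, w} k V where
  carrier := ULift.{w} (DualNumber k)
  vertex _ := 1
  piece i :=
    if i = 0 then Submodule.span k {1}
    else if i = 2 then Submodule.span k {ULift.up DualNumber.eps}
    else ⊥

/-- The skew-zigzag algebra `A_v(G)`. -/
def skewZigzag (v : SZC k G) : VertexAlgebra.{u, w} k V :=
  if Fintype.card V = 1 then dualNumberAlgebra k V
  else if Fintype.card V = 2 then quotientAlgebra (longPathIdeal k G)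
  else quotientAlgebra (relIdeal v)

variable (k G)

/-- The set of all skew-zigzag algebras of `G`. -/
abbrev AlgebraSet : Type (max (u + 1) (w + 1)) :=
  Set.range (skewZigzag : SZC k G → VertexAlgebra.{u, w} k V)

/-- The relation `∼` on the set of skew-zigzag algebras: isomorphism fixing the vertices. -/
def algSetoid : Setoid (AlgebraSet k G) where
  r A B := A.1.VertexIso B.1
  iseqv := VertexAlgebra.vertexIso_equivalence.comap Subtype.val

/-- The relation `≡` on skew-zigzag coefficients: the algebras are isomorphic by an isomorphism
fixing the vertices. -/
def szcSetoid : Setoid (SZC k G) where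
  r v u := (skewZigzag v).VertexIso (skewZigzag u)
  iseqv := VertexAlgebra.vertexIso_equivalence.comap skewZigzag

end Algebra

/-! ### Graph cohomology -/

section Cohomology

variable {V : Type w} (G : SimpleGraph V)

/-- The free abelian group on the directed edges of the double graph, modulo
`(a | b) + (b | a)`. -/
abbrev EdgeModule : Type w :=
  (G.Dart →₀ ℤ) ⧸ Submodule.span ℤ
    (Set.range fun d : G.Dart => Finsupp.single d (1 : ℤ) + Finsupp.single d.symm 1)

/-- The map `δ`, sending a directed edge to its source minus its target. -/
def delta : EdgeModule G →ₗ[ℤ] (V →₀ ℤ) :=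
  Submodule.liftQ _
    (Finsupp.linearCombination ℤ fun d : G.Dart =>
      (Finsupp.single d.fst (1 : ℤ) - Finsupp.single d.snd 1 : V →₀ ℤ))
    (by
      rw [Submodule.span_le]
      rintro _ ⟨d, rfl⟩
      simp)

/-- The space of cycles. -/
abbrev cycleSpace : Submodule ℤ (EdgeModule G) := LinearMap.ker (delta G)

/-- The graph cohomology: the group of homomorphisms from the space of cycles to `kˣ`, under
pointwise multiplication. -/
abbrev Cohomology (k : Type u) [Field k] : Type (max u w) :=
  Multiplicative (cycleSpace G) →* kˣ

variable {G}

/-- The sum of the directed edges of a path. -/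
def edgeSum {a b : V} (p : G.Walk a b) : EdgeModule G :=
  Submodule.Quotient.mk (p.darts.map fun d => Finsupp.single d (1 : ℤ)).sum

theorem delta_edgeSum {a b : V} (p : G.Walk a b) :
    delta G (edgeSum p) = Finsupp.single a 1 - Finsupp.single b 1 := by
  induction p with
  | nil => simp [edgeSum, delta]
  | cons h p ih =>
    simp only [edgeSum, delta, Submodule.liftQ_apply] at ih
    simp [edgeSum, delta, ih]

/-- The element of the space of cycles attached to a cycle. -/
def cycleClass {a : V} (p : G.Walk a a) : cycleSpace G :=
  ⟨edgeSum p, by rw [LinearMap.mem_ker, delta_edgeSum, sub_self]⟩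

end Cohomology

end

end SkewZigzagAlgebra

/-!
# Classification of skew-zigzag algebras by graph cohomology

By the cocycle conditions every collection of coefficients has the form
`v^a_{b,c} = f(a, b) / f(a, c)` for a weight `f` on the directed edges, unique up to a factor that
depends on the source `a`. Regrouping the product along a cycle by edges instead of by vertices
turns the cycle product into the product of `g(a, b) = f(b, a) / f(a, b)`. This `g` is
antisymmetric, so it extends to the edge module; changing `f` by a function of the source changes
`g` by a coboundary, so the restriction to the space of cycles depends on `v` only. This gives
`holonomy`, a homomorphism from the coefficients to graph cohomology. It is surjective: a
homomorphism on cycles extends to the edges, and an orientation turns an antisymmetric `g` into a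
weight `f`. On a connected graph, `v` and `u` have the same image exactly if
`v^a_{b,c} / u^a_{b,c} = μ(a, b) / μ(a, c)` for a *symmetric* weight `μ` (`GaugeEquiv`), because an
antisymmetric function that is trivial on cycles is a coboundary.

It remains to see that `GaugeEquiv v u` means `A_v ≅ A_u`. Given `μ`, rescaling every edge by a
square root of `μ` is an isomorphism of graded algebras. Conversely, if there are at least three
vertices, paths of length three vanish in `A_v` (`relMk_three`), so `[a] A_v [b]` is spanned by
`(a | b)` and an isomorphism fixing the vertices rescales every edge, `(a | b)` to `l(a, b) (a | b)`.
Comparing the relations at `a` gives the symmetric weight `μ(a, b) = l(a, b) l(b, a)`; this uses that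
the loops `(a | b | a)` do not vanish (`of_loop_notMem_relIdeal`), which is shown by an explicit
linear form. With at most two vertices there is only one collection of coefficients.
-/

namespace SkewZigzagAlgebra

noncomputable section

open SimpleGraph (Walk)

/-! ### Edge weights and skew-zigzag coefficients -/

section Weights

variable {k : Type u} {V : Type w} [Field k] {G : SimpleGraph V}

namespace SZC

theorem coeff_ne_zero (v : SZC k G) (a : V) (b c : G.neighborSet a) : v.coeff a b c ≠ 0 :=
  left_ne_zero_of_mul_eq_one (v.symm a b c)

theorem coeff_mul_coeff (v : SZC k G) (a : V) (b c d : G.neighborSet a) :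
    v.coeff a b c * v.coeff a c d = v.coeff a b d :=
  mul_right_cancel₀ (v.coeff_ne_zero a d b) ((v.cocycle a b c d).trans (v.symm a b d).symm)

/-- A neighbour of `a`, chosen independently of the given neighbour `b`: by proof irrelevance the
choice depends on `a` only. -/
def base {a b : V} (h : G.Adj a b) : G.neighborSet a :=
  (⟨⟨b, h⟩⟩ : Nonempty (G.neighborSet a)).some

open Classical in
/-- The weight `v^a_{b,b₀}` of the directed edge `(a | b)`, where `b₀` is a neighbour of `a` chosen
once and for all. It is `1` off the edges. -/
def weight (v : SZC k G) (a b : V) : kˣ :=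
  if h : G.Adj a b then
    ⟨v.coeff a ⟨b, h⟩ (base h), v.coeff a (base h) ⟨b, h⟩, v.symm _ _ _, v.symm _ _ _⟩
  else 1

theorem coeff_eq_weight_div (v : SZC k G) (a : V) (b c : G.neighborSet a) :
    v.coeff a b c = ((v.weight a b / v.weight a c : kˣ) : k) := by
  obtain ⟨b, hb⟩ := b
  obtain ⟨c, hc⟩ := c
  have hb' : G.Adj a b := hb
  have hc' : G.Adj a c := hc
  simp only [div_eq_mul_inv, Units.val_mul, weight, dif_pos hb', dif_pos hc']
  exact (v.coeff_mul_coeff a ⟨b, hb⟩ (base hb) ⟨c, hc⟩).symm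

theorem weight_mul (v u : SZC k G) (a b : V) : (v * u).weight a b = v.weight a b * u.weight a b := by
  by_cases h : G.Adj a b
  · ext
    simp only [weight, dif_pos h, Units.val_mul]
    rfl
  · simp only [weight, dif_neg h, one_mul]

/-- The coefficients `f(a, b) / f(a, c)` attached to a weight `f` on the directed edges. -/
def ofWeight (f : V → V → kˣ) : SZC k G where
  coeff a b c := ((f a b / f a c : kˣ) : k)
  self a b := by simp
  symm a b c := by rw [← Units.val_mul]; simp
  cocycle a b c d := by rw [← Units.val_mul, ← Units.val_mul]; simp

end SZC

/-- The ratio of the weights of the two orientations of an edge. -/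
def twist (f : V → V → kˣ) (a b : V) : kˣ := f b a / f a b

theorem twist_swap (f : V → V → kˣ) (a b : V) : twist f b a = (twist f a b)⁻¹ :=
  (inv_div _ _).symm

/-- The product of the values of `g` along the directed edges of a path. -/
def walkProd (g : V → V → kˣ) {a b : V} (p : G.Walk a b) : kˣ :=
  (p.darts.map fun d => g d.fst d.snd).prod

@[simp]
theorem walkProd_nil (g : V → V → kˣ) (a : V) : walkProd g (Walk.nil : G.Walk a a) = 1 := rfl

@[simp]
theorem walkProd_cons (g : V → V → kˣ) {a b c : V} (h : G.Adj a b) (p : G.Walk b c) :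
    walkProd g (Walk.cons h p) = g a b * walkProd g p := by
  simp [walkProd]

theorem walkProd_append (g : V → V → kˣ) {a b c : V} (p : G.Walk a b) (q : G.Walk b c) :
    walkProd g (p.append q) = walkProd g p * walkProd g q := by
  simp [walkProd]

theorem walkProd_inv (g : V → V → kˣ) {a b : V} (p : G.Walk a b) :
    walkProd (fun x y => (g x y)⁻¹) p = (walkProd g p)⁻¹ := by
  induction p with
  | nil => simp
  | cons h p ih => simp [ih, mul_comm]

/-- Regrouping the factors `f(aᵢ, aᵢ₋₁) / f(aᵢ, aᵢ₊₁)` of the product of the coefficients along a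
path by edges instead of by vertices. -/
theorem SZC.pathProd_mul_weight (v : SZC k G) {f : V → V → kˣ}
    (hf : ∀ a (b c : G.neighborSet a), v.coeff a b c = ((f a b / f a c : kˣ) : k))
    {a b c : V} (h : G.Adj a b) (p : G.Walk b c) :
    v.pathProd (Walk.cons h p) * (f c (Walk.cons h p).penultimate : k) =
      f a b * walkProd (twist f) (Walk.cons h p) := by
  induction p generalizing a with
  | nil =>
    simp only [walkProd_cons, walkProd_nil, mul_one, ← Units.val_mul, twist, mul_div_cancel]
    exact one_mul _
  | @cons b d c h' p ih =>
    have ih := ih h'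
    rw [Walk.penultimate_cons_cons, SZC.pathProd, hf, mul_assoc, ih, walkProd_cons _ h]
    simp only [← Units.val_mul, Units.val_inj, twist]
    rw [← mul_assoc, ← mul_assoc, div_mul_cancel, mul_div_cancel]

theorem SZC.cycleProd_eq (v : SZC k G) {f : V → V → kˣ}
    (hf : ∀ a (b c : G.neighborSet a), v.coeff a b c = ((f a b / f a c : kˣ) : k))
    {a : V} (p : G.Walk a a) : v.cycleProd p = (walkProd (twist f) p : k) := by
  by_cases hp : p.Nil
  · rw [SZC.cycleProd, dif_pos hp, Walk.eq_nil_iff_nil.2 hp]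
    simp
  · rw [SZC.cycleProd, dif_neg hp, hf]
    obtain ⟨b, h, q, rfl⟩ := Walk.not_nil_iff.1 hp
    have key := v.pathProd_mul_weight hf h q
    simp only [Walk.snd_cons]
    apply mul_left_cancel₀ (f a b).ne_zero
    rw [← key, ← mul_assoc, ← Units.val_mul, mul_div_cancel, mul_comm]

/-- Two collections of coefficients are gauge equivalent if they differ by the coefficients attached
to a weight on the undirected edges. -/
def GaugeEquiv (v u : SZC k G) : Prop :=
  ∃ μ : V → V → kˣ, (∀ a b, μ b a = μ a b) ∧
    ∀ a (b c : G.neighborSet a), v.coeff a b c * μ a c = u.coeff a b c * μ a b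

end Weights

/-! ### The cohomology class of a collection of coefficients -/

section Class

variable {k : Type u} {V : Type w} [Field k] {G : SimpleGraph V}

/-- The homomorphism from the edge module that extends an antisymmetric function. -/
def edgeHom (g : V → V → kˣ) (hg : ∀ a b, g b a = (g a b)⁻¹) : EdgeModule G →ₗ[ℤ] Additive kˣ :=
  Submodule.liftQ _
    (Finsupp.linearCombination ℤ fun d : G.Dart => Additive.ofMul (g d.fst d.snd))
    (by
      rw [Submodule.span_le]
      rintro _ ⟨d, rfl⟩
      simp [hg d.fst d.snd])

theorem edgeHom_edgeSum (g : V → V → kˣ) (hg : ∀ a b, g b a = (g a b)⁻¹) {a b : V}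
    (p : G.Walk a b) : edgeHom g hg (edgeSum p) = Additive.ofMul (walkProd g p) := by
  induction p with
  | nil => simp [edgeSum]
  | cons h p ih =>
    simp only [edgeSum, edgeHom, Submodule.liftQ_apply] at ih
    simp [edgeSum, edgeHom, ih]

theorem edgeHom_mul (g g' : V → V → kˣ) (hg : ∀ a b, g b a = (g a b)⁻¹)
    (hg' : ∀ a b, g' b a = (g' a b)⁻¹) (hgg : ∀ a b, g b a * g' b a = (g a b * g' a b)⁻¹) :
    edgeHom (G := G) (fun a b => g a b * g' a b) hgg = edgeHom g hg + edgeHom g' hg' := by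
  refine Submodule.linearMap_qext _ (Finsupp.lhom_ext' fun d => LinearMap.ext_ring ?_)
  simp [edgeHom]

/-- The homomorphism from coefficients to graph cohomology: the antisymmetric function
`f(b, a) / f(a, b)`, for a weight `f` with `v^a_{b,c} = f(a, b) / f(a, c)`, extended to the edge
module and restricted to the cycles. The weight `SZC.weight` is used because it is multiplicative in
`v`; by `holonomy_apply_of_weight` any other weight gives the same class. -/
def holonomy : SZC k G →* Cohomology G k :=
  MonoidHom.mk' (fun v => AddMonoidHom.toMultiplicativeLeft
    ((edgeHom (twist v.weight) (twist_swap _)).toAddMonoidHom.comp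
      (cycleSpace G).subtype.toAddMonoidHom)) (by
    intro v u
    refine MonoidHom.ext fun z => ?_
    have h : twist (v * u).weight = fun a b => twist v.weight a b * twist u.weight a b := by
      funext a b
      simp only [twist, SZC.weight_mul, mul_div_mul_comm]
    have key := edgeHom_mul (G := G) (twist v.weight) (twist u.weight) (twist_swap _) (twist_swap _)
      (fun a b => by simp only [twist_swap _ a b, mul_inv])
    have := congrArg (fun F => F (Multiplicative.toAdd z).1) key
    simp only [← h] at this
    exact this)

theorem holonomy_apply (v : SZC k G) (z : cycleSpace G) :
    holonomy v (Multiplicative.ofAdd z) =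
      (edgeHom (twist v.weight) (twist_swap _) (z : EdgeModule G)).toMul := rfl

/-- Two weights with the same ratios at every vertex differ by a function of the source, hence their
twists differ by a coboundary. -/
theorem edgeHom_twist_eq {f f' : V → V → kˣ}
    (h : ∀ a b c, G.Adj a b → G.Adj a c → f a b / f a c = f' a b / f' a c) (z : cycleSpace G) :
    edgeHom (twist f) (twist_swap f) (z : EdgeModule G) =
      edgeHom (twist f') (twist_swap f') (z : EdgeModule G) := by
  have hx : ∀ a, ∃ x : kˣ, ∀ b, G.Adj a b → f a b = x * f' a b := fun a => by
    by_cases ha : ∃ c, G.Adj a c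
    · obtain ⟨c, hc⟩ := ha
      refine ⟨f a c / f' a c, fun b hb => ?_⟩
      rw [div_mul_eq_mul_div, eq_div_iff_mul_eq', mul_comm, ← div_eq_div_iff_mul_eq_mul]
      exact (h a c b hc hb).symm
    · exact ⟨1, fun b hb => (ha ⟨b, hb⟩).elim⟩
  choose x hx using hx
  have key : edgeHom (G := G) (twist f) (twist_swap f) = edgeHom (twist f') (twist_swap f') -
      (Finsupp.linearCombination ℤ fun a => Additive.ofMul (x a)) ∘ₗ delta G := by
    refine Submodule.linearMap_qext _ (Finsupp.lhom_ext' fun d => LinearMap.ext_ring ?_)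
    simp only [edgeHom, delta, LinearMap.comp_apply, LinearMap.sub_apply, Submodule.mkQ_apply,
      Submodule.liftQ_apply, Finsupp.lsingle_apply, Finsupp.linearCombination_single, one_smul,
      map_sub, ← ofMul_div, twist, hx _ _ d.adj, hx _ _ d.adj.symm]
    congr 1
    rw [mul_div_mul_comm, div_div_eq_mul_div, mul_div_assoc, mul_comm]
  rw [key, LinearMap.sub_apply, LinearMap.comp_apply, LinearMap.mem_ker.1 z.2, map_zero, sub_zero]

theorem holonomy_apply_of_weight (v : SZC k G) {f : V → V → kˣ}
    (hf : ∀ a (b c : G.neighborSet a), v.coeff a b c = ((f a b / f a c : kˣ) : k))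
    (z : Multiplicative (cycleSpace G)) :
    holonomy v z = (edgeHom (twist f) (twist_swap f)
      ((Multiplicative.toAdd z : cycleSpace G) : EdgeModule G)).toMul := by
  refine congrArg Additive.toMul (edgeHom_twist_eq (fun a b c hb hc => ?_) (Multiplicative.toAdd z))
  rw [← Units.val_inj]
  exact (v.coeff_eq_weight_div a ⟨b, hb⟩ ⟨c, hc⟩).symm.trans (hf a ⟨b, hb⟩ ⟨c, hc⟩)

theorem holonomy_cycleClass (v : SZC k G) {a : V} (p : G.Walk a a) :
    ((holonomy v (Multiplicative.ofAdd (cycleClass p)) : kˣ) : k) = v.cycleProd p := by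
  rw [v.cycleProd_eq v.coeff_eq_weight_div, holonomy_apply, cycleClass, edgeHom_edgeSum]
  rfl

/-- An antisymmetric function that is trivial on cycles is a coboundary: its products along paths
starting at a fixed vertex depend only on the end point. -/
theorem exists_potential (hG : G.Connected) (g : V → V → kˣ) (hg : ∀ a b, g b a = (g a b)⁻¹)
    (h0 : ∀ z : cycleSpace G, edgeHom g hg (z : EdgeModule G) = 0) :
    ∃ h : V → kˣ, ∀ a b, G.Adj a b → g a b = h b / h a := by
  obtain ⟨o⟩ := hG.nonempty
  let W : ∀ a, G.Walk o a := fun a => (hG.preconnected o a).some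
  refine ⟨fun a => walkProd g (W a), fun a b hab => ?_⟩
  have hz : edgeSum (W a) + edgeSum (Walk.cons hab Walk.nil) - edgeSum (W b) ∈ cycleSpace G := by
    simp only [LinearMap.mem_ker, map_sub, map_add, delta_edgeSum]
    abel
  have := h0 ⟨_, hz⟩
  simp only [map_sub, map_add, edgeHom_edgeSum, sub_eq_zero] at this
  have := congrArg Additive.toMul this
  simp only [walkProd_cons, walkProd_nil, mul_one, toMul_add, toMul_ofMul] at this
  exact eq_div_of_mul_eq' (by rw [mul_comm]; exact this)

theorem holonomy_eq_iff (hG : G.Connected) (v u : SZC k G) :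
    holonomy v = holonomy u ↔ GaugeEquiv v u := by
  classical
  have hdiv : ∀ a b, v.weight a b = (v * u⁻¹).weight a b * u.weight a b := fun a b => by
    rw [← SZC.weight_mul, inv_mul_cancel_right]
  constructor
  · intro h
    have h1 : holonomy (v * u⁻¹) = 1 := by rw [map_mul, h, ← map_mul, mul_inv_cancel, map_one]
    obtain ⟨h, hh⟩ := exists_potential hG (twist (v * u⁻¹).weight) (twist_swap _) (fun z => by
      have := congrArg (fun F : Cohomology G k => F (Multiplicative.ofAdd z)) h1
      exact this)
    refine ⟨fun a b => if G.Adj a b then (v * u⁻¹).weight a b / h a else 1, fun a b => ?_,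
      fun a b c => ?_⟩
    · by_cases hab : G.Adj a b
      · simp only [if_pos hab, if_pos hab.symm]
        have := hh a b hab
        rw [twist, div_eq_div_iff_mul_eq_mul] at this
        rw [div_eq_div_iff_mul_eq_mul, this, mul_comm]
      · simp only [if_neg hab, if_neg fun h : G.Adj b a => hab h.symm]
    · have hb : G.Adj a b := b.2
      have hc : G.Adj a c := c.2
      simp only [if_pos hb, if_pos hc]
      rw [v.coeff_eq_weight_div, u.coeff_eq_weight_div, hdiv a b, hdiv a c,
        ← Units.val_mul, ← Units.val_mul, Units.val_inj, mul_div_mul_comm, mul_comm (_ / _),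
        mul_assoc, div_mul_div_cancel]
  · rintro ⟨μ, hμ, h⟩
    refine MonoidHom.ext fun z => ?_
    have htw : twist (fun a b => u.weight a b * μ a b) = twist u.weight := by
      funext a b
      simp only [twist, hμ a b, mul_div_mul_right_eq_div]
    rw [holonomy_apply_of_weight v (f := fun a b => u.weight a b * μ a b) (fun a b c => ?_) z]
    · simp only [htw]
      rfl
    · have := h a b c
      rw [u.coeff_eq_weight_div, ← Units.eq_mul_inv_iff_mul_eq] at this
      rw [this, ← Units.val_mul, ← Units.val_mul, Units.val_inj, mul_div_mul_comm, mul_assoc,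
        div_eq_mul_inv (μ a b)]

/-- The space of cycles is a direct summand of the edge module, since the image of `δ` is free. Hence
homomorphisms on the space of cycles extend to the edge module, although `kˣ` need not be
divisible. -/
theorem exists_retraction [Finite V] :
    ∃ r : EdgeModule G →ₗ[ℤ] cycleSpace G, ∀ z : cycleSpace G, r z = z := by
  obtain ⟨s, hs⟩ := (delta G).rangeRestrict.exists_rightInverse_of_surjective
    (LinearMap.range_rangeRestrict _)
  have hs' : ∀ y, delta G (s y) = y := fun y => congrArg Subtype.val (LinearMap.congr_fun hs y)
  refine ⟨LinearMap.codRestrict _ (LinearMap.id - s ∘ₗ (delta G).rangeRestrict) fun x => ?_,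
    fun z => ?_⟩
  · simp [hs']
  · ext
    have : (delta G).rangeRestrict (z : EdgeModule G) = 0 := Subtype.ext z.2
    simp [this]

theorem holonomy_surjective [Finite V] : Function.Surjective (holonomy : SZC k G → _) := by
  intro χ
  obtain ⟨r, hr⟩ := exists_retraction (G := G)
  classical
  -- The value of the extended homomorphism on the edge `(a | b)`.
  let g : V → V → kˣ := fun a b =>
    if h : G.Adj a b then χ (Multiplicative.ofAdd (r (edgeSum (Walk.cons h Walk.nil)))) else 1
  have hadd : ∀ d : G.Dart, (Submodule.Quotient.mk (Finsupp.single d.symm 1) : EdgeModule G) =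
      - Submodule.Quotient.mk (Finsupp.single d 1) := fun d => by
    rw [eq_neg_iff_add_eq_zero, add_comm, ← Submodule.Quotient.mk_add,
      Submodule.Quotient.mk_eq_zero]
    exact Submodule.subset_span ⟨d, rfl⟩
  have hedge : ∀ {a b : V} (h : G.Adj a b), edgeSum (Walk.cons h Walk.nil) =
      (Submodule.Quotient.mk (Finsupp.single ⟨(a, b), h⟩ 1) : EdgeModule G) := fun h => by
    simp [edgeSum]
  have hg : ∀ a b, g b a = (g a b)⁻¹ := fun a b => by
    by_cases h : G.Adj a b
    · simp only [g, dif_pos h, dif_pos h.symm, hedge]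
      rw [← map_inv, ← ofAdd_neg, ← map_neg, ← hadd]
      rfl
    · simp only [g, dif_neg h, dif_neg fun h' : G.Adj b a => h h'.symm, inv_one]
  have hhom : (edgeHom g hg : EdgeModule G →ₗ[ℤ] Additive kˣ) =
      (AddMonoidHom.toMultiplicativeLeft.symm χ).toIntLinearMap ∘ₗ r := by
    refine Submodule.linearMap_qext _ (Finsupp.lhom_ext' fun d => LinearMap.ext_ring ?_)
    simp only [edgeHom, LinearMap.comp_apply, Submodule.mkQ_apply,
      Submodule.liftQ_apply, Finsupp.lsingle_apply, Finsupp.linearCombination_single, one_smul, g,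
      dif_pos d.adj, hedge]
    rfl
  -- An orientation of the edges gives a weight whose twist is `g`.
  obtain ⟨n, ⟨e⟩⟩ := Finite.exists_equiv_fin V
  let f : V → V → kˣ := fun a b => if e a < e b then 1 else g b a
  have hf : ∀ a b, G.Adj a b → twist f a b = g a b := fun a b hab => by
    have hne : e a ≠ e b := fun h => hab.ne (e.injective h)
    rcases lt_or_gt_of_ne hne with h | h
    · simp [twist, f, h, h.not_gt]
    · simp [twist, f, h, h.not_gt, hg a b]
  have hfg : edgeHom (G := G) (twist f) (twist_swap f) = edgeHom g hg := by
    refine Submodule.linearMap_qext _ (Finsupp.lhom_ext' fun d => LinearMap.ext_ring ?_)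
    simp [edgeHom, hf _ _ d.adj]
  refine ⟨SZC.ofWeight f, MonoidHom.ext fun z => ?_⟩
  rw [holonomy_apply_of_weight (SZC.ofWeight f) (f := f) (fun _ _ _ => rfl), hfg, hhom,
    LinearMap.comp_apply, hr]
  rfl

end Class


variable {k : Type u} {V : Type w} [Field k] {G : SimpleGraph V}

/-! ### Rescaling the edges -/

section Rescale

/-- The linear map that multiplies every path by the product of the weights of its edges. -/
def rescaleLin (f : V → V → kˣ) : PathAlgebra k G →ₗ[k] PathAlgebra k G :=
  Finsupp.linearCombination k fun p : DPath G =>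
    ((walkProd f p.2.2 : kˣ) : k) • PathAlgebra.of k p.2.2

theorem rescaleLin_of (f : V → V → kˣ) {a b : V} (p : G.Walk a b) :
    rescaleLin f (PathAlgebra.of k p) = ((walkProd f p : kˣ) : k) • PathAlgebra.of k p :=
  (Finsupp.linearCombination_single k (1 : k) (⟨a, b, p⟩ : DPath G)).trans (one_smul k _)

variable [Fintype V] [DecidableEq V]

/-- The endomorphism of the path algebra that rescales the edges. -/
def rescale (f : V → V → kˣ) : PathAlgebra k G →ₐ[k] PathAlgebra k G :=
  AlgHom.ofLinearMap (rescaleLin f)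
    (by
      rw [show (1 : PathAlgebra k G) =
        ∑ a : V, PathAlgebra.of k (SimpleGraph.Walk.nil : G.Walk a a) from rfl, map_sum]
      simp [rescaleLin_of])
    (fun x y => by
      have key : (PathAlgebra.mulLin (k := k) (G := G)).compr₂ (rescaleLin f) =
          PathAlgebra.mulLin.compl₁₂ (rescaleLin f) (rescaleLin f) := by
        refine PathAlgebra.lin_ext fun a b p => PathAlgebra.lin_ext fun c d q => ?_
        simp only [LinearMap.compr₂_apply, LinearMap.compl₁₂_apply, PathAlgebra.mulLin_apply,
          rescaleLin_of, smul_mul_smul_comm]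
        by_cases h : b = c
        · subst h
          simp only [PathAlgebra.of_mul_of, rescaleLin_of, walkProd_append, Units.val_mul]
        · simp only [PathAlgebra.of_mul_of_ne _ _ h, map_zero, smul_zero]
      exact congrArg (fun F => F x y) key)

theorem rescale_of (f : V → V → kˣ) {a b : V} (p : G.Walk a b) :
    rescale f (PathAlgebra.of k p) = ((walkProd f p : kˣ) : k) • PathAlgebra.of k p :=
  rescaleLin_of f p

theorem rescale_inv_comp (f : V → V → kˣ) :
    (rescale (k := k) (G := G) fun a b => (f a b)⁻¹).comp (rescale f) = AlgHom.id k _ := by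
  apply AlgHom.toLinearMap_injective
  refine PathAlgebra.lin_ext fun a b p => ?_
  simp [rescale_of, walkProd_inv]

theorem smul_mem_twoSidedIdeal {A : Type*} [Ring A] [Algebra k A] (I : TwoSidedIdeal A) (c : k)
    {x : A} (hx : x ∈ I) : c • x ∈ I := by
  rw [Algebra.smul_def]
  exact I.mul_mem_left _ _ hx

/-- Rescaling the edges maps the relations of `v` to those of `u` if the products of the weights of
the two orientations of the edges account for the difference between `v` and `u`. -/
theorem rescale_mem_relIdeal {v u : SZC k G} {f : V → V → kˣ}
    (h : ∀ a (b c : G.neighborSet a),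
      v.coeff a b c * (f a c * f c a : kˣ) = u.coeff a b c * (f a b * f b a : kˣ))
    {x : PathAlgebra k G} (hx : x ∈ relIdeal v) : rescale f x ∈ relIdeal u := by
  suffices relIdeal v ≤ TwoSidedIdeal.comap (rescale f) (relIdeal u) from this hx
  rw [relIdeal, TwoSidedIdeal.span_le]
  rintro _ (⟨a, b, c, hab, hbc, hac, rfl⟩ | ⟨a, b, c, hab, hac, rfl⟩)
  · rw [SetLike.mem_coe, TwoSidedIdeal.mem_comap, rescale_of]
    exact smul_mem_twoSidedIdeal _ _
      (TwoSidedIdeal.subset_span (Or.inl ⟨a, b, c, hab, hbc, hac, rfl⟩))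
  · rw [SetLike.mem_coe, TwoSidedIdeal.mem_comap, map_sub, map_smul, rescale_of, rescale_of,
      smul_smul]
    simp only [walkProd_cons, walkProd_nil, mul_one]
    rw [h a ⟨b, hab⟩ ⟨c, hac⟩, mul_comm (u.coeff _ _ _), ← smul_smul, ← smul_sub]
    exact smul_mem_twoSidedIdeal _ _
      (TwoSidedIdeal.subset_span (Or.inr ⟨a, b, c, hab, hac, rfl⟩))

/-- The homomorphism of skew-zigzag algebras induced by rescaling the edges. -/
def rescaleQuot {v u : SZC k G} (f : V → V → kˣ)
    (h : ∀ a (b c : G.neighborSet a),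
      v.coeff a b c * (f a c * f c a : kˣ) = u.coeff a b c * (f a b * f b a : kˣ)) :
    (PathAlgebra k G ⧸ (relIdeal v).asIdeal) →ₐ[k] (PathAlgebra k G ⧸ (relIdeal u).asIdeal) :=
  Ideal.Quotient.liftₐ _ ((Ideal.Quotient.mkₐ k _).comp (rescale f)) fun _ hx =>
    Ideal.Quotient.eq_zero_iff_mem.2
      (TwoSidedIdeal.mem_asIdeal.2 (rescale_mem_relIdeal h (TwoSidedIdeal.mem_asIdeal.1 hx)))

theorem rescaleQuot_of {v u : SZC k G} (f : V → V → kˣ)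
    (h : ∀ a (b c : G.neighborSet a),
      v.coeff a b c * (f a c * f c a : kˣ) = u.coeff a b c * (f a b * f b a : kˣ))
    {a b : V} (p : G.Walk a b) :
    rescaleQuot f h (Ideal.Quotient.mk _ (PathAlgebra.of k p)) =
      ((walkProd f p : kˣ) : k) • Ideal.Quotient.mk _ (PathAlgebra.of k p) :=
  congrArg (Ideal.Quotient.mkₐ k (relIdeal u).asIdeal) (rescale_of f p)

theorem rescaleQuot_comp {v u : SZC k G} (f f' : V → V → kˣ)
    (h : ∀ a (b c : G.neighborSet a),
      v.coeff a b c * (f a c * f c a : kˣ) = u.coeff a b c * (f a b * f b a : kˣ))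
    (h' : ∀ a (b c : G.neighborSet a),
      u.coeff a b c * (f' a c * f' c a : kˣ) = v.coeff a b c * (f' a b * f' b a : kˣ))
    (hf : ∀ a b, f' a b = (f a b)⁻¹) :
    (rescaleQuot f' h').comp (rescaleQuot f h) = AlgHom.id k _ := by
  obtain rfl : f' = fun a b => (f a b)⁻¹ := by
    funext a b
    exact hf a b
  apply Ideal.Quotient.algHom_ext
  apply AlgHom.ext
  intro x
  exact congrArg (Ideal.Quotient.mkₐ k (relIdeal v).asIdeal)
    (DFunLike.congr_fun (rescale_inv_comp f) x)

theorem map_rescaleQuot_span {v u : SZC k G} (f : V → V → kˣ)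
    (h : ∀ a (b c : G.neighborSet a),
      v.coeff a b c * (f a c * f c a : kˣ) = u.coeff a b c * (f a b * f b a : kˣ)) (i : ℕ) :
    (Submodule.span k {x : PathAlgebra k G ⧸ (relIdeal v).asIdeal |
        ∃ (a b : V) (p : G.Walk a b), p.length = i ∧
          x = Ideal.Quotient.mk _ (PathAlgebra.of k p)}).map (rescaleQuot f h).toLinearMap =
      Submodule.span k {x : PathAlgebra k G ⧸ (relIdeal u).asIdeal |
        ∃ (a b : V) (p : G.Walk a b), p.length = i ∧
          x = Ideal.Quotient.mk _ (PathAlgebra.of k p)} := by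
  apply le_antisymm
  · refine (Submodule.map_span_le _ _ _).2 ?_
    rintro _ ⟨a, b, p, hp, rfl⟩
    rw [AlgHom.toLinearMap_apply, rescaleQuot_of]
    exact Submodule.smul_mem _ _ (Submodule.subset_span ⟨a, b, p, hp, rfl⟩)
  · refine Submodule.span_le.2 ?_
    rintro _ ⟨a, b, p, hp, rfl⟩
    refine ⟨((walkProd f p : kˣ) : k)⁻¹ • Ideal.Quotient.mk _ (PathAlgebra.of k p),
      Submodule.smul_mem _ _ (Submodule.subset_span ⟨a, b, p, hp, rfl⟩), ?_⟩
    rw [AlgHom.toLinearMap_apply, map_smul, rescaleQuot_of, smul_smul,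
      inv_mul_cancel₀ (Units.ne_zero _), one_smul]

/-- If every element of the field is a square, gauge equivalent coefficients give isomorphic graded
algebras: every edge is rescaled by a square root of the weight. -/
theorem GaugeEquiv.gradedVertexIso (hk : ∀ x : k, IsSquare x) {v u : SZC k G}
    (hvu : GaugeEquiv v u) :
    (quotientAlgebra (relIdeal v)).GradedVertexIso (quotientAlgebra (relIdeal u)) := by
  obtain ⟨μ, hμ, h⟩ := hvu
  have hs : ∀ x : kˣ, ∃ y : kˣ, y * y = x := fun x => by
    obtain ⟨y, hy⟩ := hk x
    have hy0 : y ≠ 0 := fun h0 => x.ne_zero (by rw [hy, h0, zero_mul])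
    exact ⟨Units.mk0 y hy0, Units.ext hy.symm⟩
  choose s hs using hs
  have hf : ∀ a (b c : G.neighborSet a), v.coeff a b c * (s (μ a c) * s (μ c a) : kˣ) =
      u.coeff a b c * (s (μ a b) * s (μ b a) : kˣ) := fun a b c => by
    rw [hμ a b, hμ a c, hs, hs, h]
  have hf' : ∀ a (b c : G.neighborSet a), u.coeff a b c * ((s (μ a c))⁻¹ * (s (μ c a))⁻¹ : kˣ) =
      v.coeff a b c * ((s (μ a b))⁻¹ * (s (μ b a))⁻¹ : kˣ) := fun a b c => by
    have := hf a b c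
    rw [← mul_inv, ← mul_inv, ← Units.mul_inv_eq_iff_eq_mul, mul_right_comm, inv_inv, ← this,
      Units.mul_inv_cancel_right]
  refine ⟨AlgEquiv.ofAlgHom (rescaleQuot (fun a b => s (μ a b)) hf)
    (rescaleQuot (fun a b => (s (μ a b))⁻¹) hf') (rescaleQuot_comp _ _ _ _ fun a b => (inv_inv _).symm)
    (rescaleQuot_comp _ _ _ _ fun a b => rfl), fun a => ?_, fun i => ?_⟩
  · refine (rescaleQuot_of (fun a b => s (μ a b)) hf (Walk.nil : G.Walk a a)).trans ?_
    rw [walkProd_nil, Units.val_one, one_smul]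
    rfl
  · exact map_rescaleQuot_span _ hf i

end Rescale

/-! ### The structure of a skew-zigzag algebra -/

section Structure

/-- The weight `f(a, b)` of a path `(a | b | a)`, and `0` for any other path. -/
def loopWeight [DecidableEq V] (f : V → V → kˣ) : {a b : V} → G.Walk a b → k
  | a, c, .cons (v := b) _ (.cons _ .nil) => if a = c then f a b else 0
  | _, _, _ => 0

theorem loopWeight_of_length_ne [DecidableEq V] (f : V → V → kˣ) {a b : V} (p : G.Walk a b)
    (hp : p.length ≠ 2) : loopWeight f p = 0 := by
  match p with
  | .nil => rfl
  | .cons _ .nil => rfl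
  | .cons _ (.cons _ .nil) => exact (hp rfl).elim
  | .cons _ (.cons _ (.cons _ _)) => rfl

/-- The linear extension of `loopWeight`. -/
def loopForm [DecidableEq V] (f : V → V → kˣ) : PathAlgebra k G →ₗ[k] k :=
  Finsupp.linearCombination k fun p : DPath G => loopWeight f p.2.2

theorem loopForm_of [DecidableEq V] (f : V → V → kˣ) {a b : V} (p : G.Walk a b) :
    loopForm f (PathAlgebra.of k p) = loopWeight f p :=
  (Finsupp.linearCombination_single k (1 : k) (⟨a, b, p⟩ : DPath G)).trans (one_smul k _)

variable [Fintype V] [DecidableEq V]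

/-- The largest two-sided ideal in the kernel of a linear form. -/
def formIdeal {A : Type*} [Ring A] [Algebra k A] (t : A →ₗ[k] k) : TwoSidedIdeal A :=
  TwoSidedIdeal.mk' {x | ∀ y z, t (y * x * z) = 0} (by simp)
    (fun hx hy _ _ => by simp [mul_add, add_mul, hx _ _, hy _ _])
    (fun hx _ _ => by simp [hx _ _])
    (fun {x y} hy a b => by rw [← mul_assoc a]; exact hy _ _)
    (fun {x y} hx a b => by rw [← mul_assoc a, mul_assoc (a * x)]; exact hx _ _)

theorem mem_formIdeal {A : Type*} [Ring A] [Algebra k A] {t : A →ₗ[k] k} {x : A} :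
    x ∈ formIdeal t ↔ ∀ y z, t (y * x * z) = 0 :=
  TwoSidedIdeal.mem_mk' _ _ _ _ _ _ _

theorem mem_formIdeal_of_paths {t : PathAlgebra k G →ₗ[k] k} {x : PathAlgebra k G}
    (h : ∀ (a b c d : V) (p : G.Walk a b) (q : G.Walk c d),
      t (PathAlgebra.of k p * x * PathAlgebra.of k q) = 0) : x ∈ formIdeal t := by
  rw [mem_formIdeal]
  intro y z
  have key : ((LinearMap.mul k (PathAlgebra k G)).comp (LinearMap.mulRight k x)).compr₂ t = 0 :=
    PathAlgebra.lin_ext fun a b p => PathAlgebra.lin_ext fun c d q => h a b c d p q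
  exact congrArg (fun F => F y z) key

/-- A path of length two multiplied by paths on both sides: `loopForm` sees the product only if
both factors are trivial. -/
theorem loopForm_mul_of_mul (f : V → V → kˣ) {a b c d e g : V} (p : G.Walk a b) (r : G.Walk c d)
    (q : G.Walk e g) (hr : r.length = 2) :
    loopForm f (PathAlgebra.of k p * PathAlgebra.of k r * PathAlgebra.of k q) =
      if p.length = 0 ∧ q.length = 0 ∧ b = c ∧ d = e then loopWeight f r else 0 := by
  by_cases hbc : b = c
  · subst hbc
    by_cases hde : d = e
    · subst hde
      rw [PathAlgebra.of_mul_of, PathAlgebra.of_mul_of, loopForm_of]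
      cases p with
      | nil =>
        cases q with
        | nil => simp
        | cons h q =>
          rw [loopWeight_of_length_ne, if_neg] <;> simp [hr]
      | cons h p =>
        rw [loopWeight_of_length_ne, if_neg]
        · simp
        · simp [hr]
          omega
    · rw [PathAlgebra.of_mul_of, PathAlgebra.of_mul_of_ne _ _ hde, map_zero, if_neg]
      exact fun h => hde h.2.2.2
  · rw [PathAlgebra.of_mul_of_ne _ _ hbc, zero_mul, map_zero, if_neg]
    exact fun h => hbc h.2.2.1

/-- The paths `(a | b | a)` do not vanish in a skew-zigzag algebra. -/
theorem of_loop_notMem_relIdeal (u : SZC k G) {a b : V} (h : G.Adj a b) :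
    PathAlgebra.of k (Walk.cons h (Walk.cons h.symm Walk.nil)) ∉ relIdeal u := by
  intro hmem
  have hle : relIdeal u ≤ formIdeal (loopForm u.weight) := by
    rw [relIdeal, TwoSidedIdeal.span_le]
    rintro _ (⟨a, b, c, hab, hbc, hac, rfl⟩ | ⟨a, b, c, hab, hac, rfl⟩)
    · refine mem_formIdeal_of_paths fun x y z t p q => ?_
      rw [loopForm_mul_of_mul _ _ _ _ rfl]
      simp [loopWeight, hac]
    · refine mem_formIdeal_of_paths fun x y z t p q => ?_
      rw [mul_sub, sub_mul, mul_smul_comm, smul_mul_assoc, map_sub, map_smul,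
        loopForm_mul_of_mul _ _ _ _ rfl, loopForm_mul_of_mul _ _ _ _ rfl]
      split_ifs
      · simp only [loopWeight, if_true, u.coeff_eq_weight_div, smul_eq_mul, ← Units.val_mul,
          div_mul_cancel, sub_self]
      · simp
  have h0 := mem_formIdeal.1 (hle hmem) 1 1
  rw [one_mul, mul_one, loopForm_of] at h0
  simp [loopWeight] at h0

/-- The class of a path in a skew-zigzag algebra. -/
abbrev relMk (v : SZC k G) : PathAlgebra k G →ₐ[k] PathAlgebra k G ⧸ (relIdeal v).asIdeal :=
  Ideal.Quotient.mkₐ k (relIdeal v).asIdeal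

theorem relMk_eq_zero {v : SZC k G} {x : PathAlgebra k G} : relMk v x = 0 ↔ x ∈ relIdeal v :=
  Ideal.Quotient.eq_zero_iff_mem.trans TwoSidedIdeal.mem_asIdeal

theorem relMk_of_ne (v : SZC k G) {a b c : V} (h : G.Adj a b) (h' : G.Adj b c) (hac : a ≠ c) :
    relMk v (PathAlgebra.of k (Walk.cons h (Walk.cons h' Walk.nil))) = 0 :=
  relMk_eq_zero.2 (TwoSidedIdeal.subset_span (Or.inl ⟨a, b, c, h, h', hac, rfl⟩))

theorem relMk_loop (v : SZC k G) {a b c : V} (h : G.Adj a b) (h' : G.Adj a c) :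
    relMk v (PathAlgebra.of k (Walk.cons h (Walk.cons h.symm Walk.nil))) =
      v.coeff a ⟨b, h⟩ ⟨c, h'⟩ •
        relMk v (PathAlgebra.of k (Walk.cons h' (Walk.cons h'.symm Walk.nil))) := by
  rw [← sub_eq_zero, ← map_smul, ← map_sub]
  exact relMk_eq_zero.2 (TwoSidedIdeal.subset_span (Or.inr ⟨a, b, c, h, h', rfl⟩))

/-- A connected graph with at least three vertices has no isolated edge. -/
theorem exists_other_neighbor (hG : G.Connected) (hV : 2 < Fintype.card V) {a b : V}
    (h : G.Adj a b) : (∃ c, G.Adj a c ∧ c ≠ b) ∨ ∃ c, G.Adj b c ∧ c ≠ a := by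
  by_contra! hcon
  obtain ⟨ha, hb⟩ := hcon
  -- The set `{a, b}` is closed under passing to neighbours, so it contains every vertex.
  have hclosed : ∀ {x y : V} (p : G.Walk x y), x = a ∨ x = b → y = a ∨ y = b := by
    intro x y p
    induction p with
    | nil => exact id
    | cons hxy p ih =>
      rintro (rfl | rfl)
      · exact ih (Or.inr (ha _ hxy))
      · exact ih (Or.inl (hb _ hxy))
  have hcard : Finset.univ ⊆ ({a, b} : Finset V) := fun x _ => by
    obtain ⟨p⟩ := hG.preconnected a x
    simpa using hclosed p (Or.inl rfl)
  have := Finset.card_le_card hcard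
  rw [Finset.card_univ] at this
  exact absurd (this.trans Finset.card_le_two) (by omega)

/-- Paths of length three vanish: `(a | b | a | b)` is a multiple of `(a | c | a | b)` for
any other neighbour `c` of `a`, and of `(a | b | c | b)` for any other neighbour `c` of `b`. -/
theorem relMk_three (hG : G.Connected) (hV : 2 < Fintype.card V) (v : SZC k G) {a b c d : V}
    (h : G.Adj a b) (h' : G.Adj b c) (h'' : G.Adj c d) :
    relMk v (PathAlgebra.of k (Walk.cons h (Walk.cons h' (Walk.cons h'' Walk.nil)))) = 0 := by
  have hl : ∀ {a b c d : V} (h : G.Adj a b) (h' : G.Adj b c) (h'' : G.Adj c d),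
      relMk v (PathAlgebra.of k (Walk.cons h (Walk.cons h' (Walk.cons h'' Walk.nil)))) =
        relMk v (PathAlgebra.of k (Walk.cons h (Walk.cons h' Walk.nil))) *
          relMk v (PathAlgebra.of k (Walk.cons h'' Walk.nil)) := fun h h' h'' => by
    rw [← map_mul, PathAlgebra.of_mul_of]
    rfl
  have hr : ∀ {a b c d : V} (h : G.Adj a b) (h' : G.Adj b c) (h'' : G.Adj c d),
      relMk v (PathAlgebra.of k (Walk.cons h (Walk.cons h' (Walk.cons h'' Walk.nil)))) =
        relMk v (PathAlgebra.of k (Walk.cons h Walk.nil)) *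
          relMk v (PathAlgebra.of k (Walk.cons h' (Walk.cons h'' Walk.nil))) := fun h h' h'' => by
    rw [← map_mul, PathAlgebra.of_mul_of]
    rfl
  by_cases hac : a = c
  · subst hac
    by_cases hbd : b = d
    · subst hbd
      rcases exists_other_neighbor hG hV h with ⟨e, he, hne⟩ | ⟨e, he, hne⟩
      · rw [hl, relMk_loop v h he, smul_mul_assoc, ← hl, hr, relMk_of_ne v he.symm h'' hne,
          mul_zero, smul_zero]
      · rw [hr, relMk_loop v h' he, mul_smul_comm, ← hr, hl, relMk_of_ne v h he hne.symm,
          zero_mul, smul_zero]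
    · rw [hr, relMk_of_ne v h' h'' hbd, mul_zero]
  · rw [hl, relMk_of_ne v h h' hac, zero_mul]

theorem exists_relMk_eq_smul_edge (hG : G.Connected) (hV : 2 < Fintype.card V) (v : SZC k G)
    {a b : V} (h : G.Adj a b) (p : G.Walk a b) :
    ∃ c : k, relMk v (PathAlgebra.of k p) =
      c • relMk v (PathAlgebra.of k (Walk.cons h Walk.nil)) := by
  cases p with
  | nil => exact (h.ne rfl).elim
  | cons h₁ p =>
    cases p with
    | nil => exact ⟨1, (one_smul _ _).symm⟩
    | cons h₂ p =>
      refine ⟨0, ?_⟩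
      rw [zero_smul]
      cases p with
      | nil => exact relMk_of_ne v h₁ h₂ h.ne
      | cons h₃ q =>
        rw [← zero_mul (relMk v (PathAlgebra.of k q)), ← relMk_three hG hV v h₁ h₂ h₃, ← map_mul,
          PathAlgebra.of_mul_of]
        rfl

/-- The component `[a] A [b]` for an edge `(a | b)` is spanned by the class of that edge. -/
theorem exists_smul_edge (hG : G.Connected) (hV : 2 < Fintype.card V) (v : SZC k G) {a b : V}
    (h : G.Adj a b) (x : PathAlgebra k G ⧸ (relIdeal v).asIdeal) :
    ∃ c : k, relMk v (PathAlgebra.of k (Walk.nil : G.Walk a a)) * x *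
      relMk v (PathAlgebra.of k (Walk.nil : G.Walk b b)) =
        c • relMk v (PathAlgebra.of k (Walk.cons h Walk.nil)) := by
  obtain ⟨y, rfl⟩ := Ideal.Quotient.mkₐ_surjective k _ x
  let S := Submodule.span k {relMk v (PathAlgebra.of k (Walk.cons h Walk.nil))}
  let F := (LinearMap.mulLeftRight k (relMk v (PathAlgebra.of k (Walk.nil : G.Walk a a)),
    relMk v (PathAlgebra.of k (Walk.nil : G.Walk b b)))).comp (relMk v).toLinearMap
  have hF : ∀ y, F y = relMk v (PathAlgebra.of k (Walk.nil : G.Walk a a)) * relMk v y *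
    relMk v (PathAlgebra.of k (Walk.nil : G.Walk b b)) := fun y => LinearMap.mulLeftRight_apply ..
  have key : S.mkQ ∘ₗ F = 0 := by
    refine PathAlgebra.lin_ext fun c d p => ?_
    rw [LinearMap.comp_apply, LinearMap.zero_apply, Submodule.mkQ_apply,
      Submodule.Quotient.mk_eq_zero, hF, ← map_mul, ← map_mul]
    by_cases hac : a = c
    · subst hac
      by_cases hdb : d = b
      · subst hdb
        rw [PathAlgebra.of_mul_of, PathAlgebra.of_mul_of, Walk.nil_append, Walk.append_nil]
        exact Submodule.mem_span_singleton.2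
          ((exists_relMk_eq_smul_edge hG hV v h p).imp fun _ h => h.symm)
      · rw [PathAlgebra.of_mul_of, PathAlgebra.of_mul_of_ne _ _ hdb, map_zero]
        exact S.zero_mem
    · rw [PathAlgebra.of_mul_of_ne _ _ hac, zero_mul, map_zero]
      exact S.zero_mem
  have hy : F y ∈ S := (Submodule.Quotient.mk_eq_zero S).1 (LinearMap.congr_fun key y)
  obtain ⟨c, hc⟩ := Submodule.mem_span_singleton.1 hy
  exact ⟨c, by rw [hc, hF]⟩

/-- An isomorphism fixing the vertices rescales every edge, and the resulting weights on the
undirected edges account for the difference between the coefficients. -/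
theorem gaugeEquiv_of_vertexIso (hG : G.Connected) (hV : 2 < Fintype.card V) {v u : SZC k G}
    (h : (quotientAlgebra (relIdeal v)).VertexIso (quotientAlgebra (relIdeal u))) :
    GaugeEquiv v u := by
  classical
  obtain ⟨φ, hφ⟩ := h
  change (PathAlgebra k G ⧸ (relIdeal v).asIdeal) ≃ₐ[k] (PathAlgebra k G ⧸ (relIdeal u).asIdeal)
    at φ
  replace hφ : ∀ a, φ (relMk v (PathAlgebra.of k (Walk.nil : G.Walk a a))) =
    relMk u (PathAlgebra.of k (Walk.nil : G.Walk a a)) := hφ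
  have hedge : ∀ a b, ∃ c : k, ∀ h : G.Adj a b,
      φ (relMk v (PathAlgebra.of k (Walk.cons h Walk.nil))) =
        c • relMk u (PathAlgebra.of k (Walk.cons h Walk.nil)) := fun a b => by
    by_cases h : G.Adj a b
    · obtain ⟨c, hc⟩ := exists_smul_edge hG hV u h
        (φ (relMk v (PathAlgebra.of k (Walk.cons h Walk.nil))))
      refine ⟨c, fun _ => ?_⟩
      rw [← hc, ← hφ, ← hφ, ← map_mul, ← map_mul, ← map_mul, ← map_mul, PathAlgebra.of_mul_of,
        PathAlgebra.of_mul_of]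
      rfl
    · exact ⟨0, fun h' => (h h').elim⟩
  choose l hl using hedge
  have hloop : ∀ {a b : V} (h : G.Adj a b),
      φ (relMk v (PathAlgebra.of k (Walk.cons h (Walk.cons h.symm Walk.nil)))) =
        (l a b * l b a) • relMk u (PathAlgebra.of k (Walk.cons h (Walk.cons h.symm Walk.nil))) := by
    intro a b h
    have hmul : ∀ w : SZC k G,
        relMk w (PathAlgebra.of k (Walk.cons h (Walk.cons h.symm Walk.nil))) =
          relMk w (PathAlgebra.of k (Walk.cons h Walk.nil)) *
            relMk w (PathAlgebra.of k (Walk.cons h.symm Walk.nil)) := fun w => by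
      rw [← map_mul, PathAlgebra.of_mul_of]
      rfl
    rw [hmul v, hmul u, map_mul, hl, hl, smul_mul_smul_comm]
  have hne : ∀ {a b : V}, G.Adj a b → l a b * l b a ≠ 0 := fun {a b} h h0 => by
    have := hloop h
    rw [h0, zero_smul, EmbeddingLike.map_eq_zero_iff, relMk_eq_zero] at this
    exact of_loop_notMem_relIdeal v h this
  refine ⟨fun a b => if h : G.Adj a b then Units.mk0 (l a b * l b a) (hne h) else 1,
    fun a b => ?_, fun a b c => ?_⟩
  · by_cases h : G.Adj a b
    · simp only [dif_pos h, dif_pos h.symm, mul_comm]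
    · simp only [dif_neg h, dif_neg fun h' : G.Adj b a => h h'.symm]
  · obtain ⟨b, hb⟩ := b
    obtain ⟨c, hc⟩ := c
    have hb' : G.Adj a b := hb
    have hc' : G.Adj a c := hc
    simp only [dif_pos hb', dif_pos hc', Units.val_mk0]
    have key := congrArg φ (relMk_loop v hb' hc')
    rw [map_smul, hloop, hloop, relMk_loop u hb' hc', smul_smul, smul_smul] at key
    have hne' := mt relMk_eq_zero.1 (of_loop_notMem_relIdeal u hc')
    rw [mul_comm (u.coeff _ _ _)]
    exact (smul_left_injective k hne' key).symm

end Structure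

/-! ### Classification -/

section Classification

theorem VertexAlgebra.GradedVertexIso.vertexIso {A B : VertexAlgebra.{u, w} k V}
    (h : A.GradedVertexIso B) : A.VertexIso B := by
  obtain ⟨φ, hφ, -⟩ := h
  exact ⟨φ, hφ⟩

theorem VertexAlgebra.GradedVertexIso.refl (A : VertexAlgebra.{u, w} k V) : A.GradedVertexIso A :=
  ⟨AlgEquiv.refl, fun _ => rfl, fun _ => Submodule.map_id _⟩

variable [Fintype V] [DecidableEq V]

/-- On at most two vertices every vertex has at most one neighbour, so all coefficients are `1`. -/
theorem SZC.subsingleton (hV : Fintype.card V ≤ 2) : Subsingleton (SZC k G) := by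
  refine ⟨fun v u => SZC.ext ?_⟩
  funext a b c
  have hbc : b = c := by
    by_contra hne
    have hb : a ≠ b := G.ne_of_adj b.2
    have hc : a ≠ c := G.ne_of_adj c.2
    have := Finset.card_le_univ ({a, ↑b, ↑c} : Finset V)
    rw [Finset.card_eq_three.2 ⟨a, b, c, hb, hc, fun h => hne (Subtype.ext h), rfl⟩] at this
    omega
  rw [hbc, v.self, u.self]

theorem skewZigzag_of_two_lt (hV : 2 < Fintype.card V) (v : SZC k G) :
    skewZigzag v = quotientAlgebra (relIdeal v) := by
  rw [skewZigzag, if_neg (by omega), if_neg (by omega)]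

theorem gradedVertexIso_of_gaugeEquiv (hk : ∀ x : k, IsSquare x) {v u : SZC k G}
    (h : GaugeEquiv v u) : (skewZigzag v).GradedVertexIso (skewZigzag u) := by
  rcases le_or_gt (Fintype.card V) 2 with hV | hV
  · have := SZC.subsingleton (k := k) (G := G) hV
    rw [Subsingleton.elim v u]
    exact .refl _
  · rw [skewZigzag_of_two_lt hV, skewZigzag_of_two_lt hV]
    exact h.gradedVertexIso hk

theorem vertexIso_iff_gaugeEquiv (hk : ∀ x : k, IsSquare x) (hG : G.Connected) (v u : SZC k G) :
    (skewZigzag v).VertexIso (skewZigzag u) ↔ GaugeEquiv v u := by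
  refine ⟨fun h => ?_, fun h => (gradedVertexIso_of_gaugeEquiv hk h).vertexIso⟩
  rcases le_or_gt (Fintype.card V) 2 with hV | hV
  · have := SZC.subsingleton (k := k) (G := G) hV
    rw [Subsingleton.elim v u]
    exact ⟨fun _ _ => 1, fun _ _ => rfl, fun _ _ _ => rfl⟩
  · rw [skewZigzag_of_two_lt hV, skewZigzag_of_two_lt hV] at h
    exact gaugeEquiv_of_vertexIso hG hV h

end Classification

end

end SkewZigzagAlgebra

theorem theorem1 {k : Type u} [Field k] (hk : ∀ x : k, IsSquare x)
    {V : Type w} [Fintype V] [DecidableEq V] (G : SimpleGraph V) (hG : G.Connected) :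
    -- `≡` is a congruence on the group of coefficients, so that its quotient is a group
    ∃ c : Con (SkewZigzagAlgebra.SZC k G),
      c.toSetoid = SkewZigzagAlgebra.szcSetoid k G ∧
      -- the set of algebras modulo `∼` is in bijection with the coefficients modulo `≡`
      (∃ Φ : Quotient (SkewZigzagAlgebra.algSetoid k G) ≃ c.Quotient,
        ∀ v : SkewZigzagAlgebra.SZC k G,
          Φ (Quotient.mk _ ⟨SkewZigzagAlgebra.skewZigzag v, v, rfl⟩) = (v : c.Quotient)) ∧
      -- the group of coefficients modulo `≡` is isomorphic to the graph cohomology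
      (∃ Ψ : c.Quotient ≃* SkewZigzagAlgebra.Cohomology G k,
        ∀ (v : SkewZigzagAlgebra.SZC k G) (a : V) (p : G.Walk a a),
          ((Ψ (v : c.Quotient) (Multiplicative.ofAdd (SkewZigzagAlgebra.cycleClass p)) : kˣ) : k) =
            v.cycleProd p) ∧
      -- nothing changes if the isomorphisms are required to preserve the gradings
      (∀ v u : SkewZigzagAlgebra.SZC k G,
        (SkewZigzagAlgebra.skewZigzag v).VertexIso (SkewZigzagAlgebra.skewZigzag u) ↔
          (SkewZigzagAlgebra.skewZigzag v).GradedVertexIso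
            (SkewZigzagAlgebra.skewZigzag u)) := by
  open SkewZigzagAlgebra in
  have hiso := vertexIso_iff_gaugeEquiv hk hG
  have hrel : ∀ v u : SZC k G,
      (Con.ker (holonomy : SZC k G →* _)) v u ↔ (skewZigzag v).VertexIso (skewZigzag u) :=
    fun v u => by rw [Con.ker_rel, holonomy_eq_iff hG, hiso]
  refine ⟨Con.ker holonomy, Setoid.ext hrel, ?_, ?_, fun v u => ?_⟩
  · let F : (Con.ker (holonomy : SZC k G →* Cohomology G k)).Quotient →
        Quotient (algSetoid k G) :=
      Quotient.map (fun v => ⟨skewZigzag v, v, rfl⟩) fun v u h => (hrel v u).1 h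
    have hF : Function.Bijective F := by
      constructor
      · rintro ⟨v⟩ ⟨u⟩ h
        exact Quotient.sound ((hrel v u).2 (Quotient.exact h))
      · rintro ⟨_, v, rfl⟩
        exact ⟨(v : (Con.ker holonomy).Quotient), rfl⟩
    exact ⟨(Equiv.ofBijective F hF).symm, fun v =>
      (Equiv.ofBijective F hF).symm_apply_apply (v : (Con.ker holonomy).Quotient)⟩
  · exact ⟨Con.quotientKerEquivOfSurjective holonomy holonomy_surjective,
      fun v a p => holonomy_cycleClass v p⟩
  · exact ⟨fun h => gradedVertexIso_of_gaugeEquiv hk ((hiso v u).1 h), fun h => h.vertexIso⟩
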